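/- Let $a<b$ be real numbers and let $\mu$ be a Borel probability measure on $\mathbb{R}$ with $\mathrm{Supp}(\mu)\subset[a,b]$, $\{a,b\}\subset\mathrm{Supp}(\mu)$ and $\mu(\{b\})>0$. Let $C(w)=\int_a^b\frac{\mu(dx)}{w-x}$ be the Cauchy transform of $\mu$. For $(\chi,\eta)\in[a,b]\times[0,1]$ and $w\in(\mathbb{C}\setminus\mathbb{R})\cup(b,\infty)$ put $$f_{(\chi,\eta)}(w)=\int_a^b\log(w-x)\,\mu(dx)-(1-\eta)\log(w-\chi)$$ with the principal branch of the logarithm, so that $f'_{(\chi,\eta)}(w)=C(w)-\frac{1-\eta}{w-\chi}$. Let $\mathcal{O}$ be the set of all $(\chi,\eta)\in[a,b]\times[0,1]$ with $\chi<b$ and $\eta>0$ for which $f'_{(\chi,\eta)}$ has a root of multiplicity $1$ in $(b,\infty)$, and let $\angle=\{(t,s)\in(b,\infty)^2:t>s\}$. Then $\mathcal{O}$ equals the set of all $(\chi,\eta)\in(a,b)\times(0,1)$ for which $1-\eta>\mu(\{\chi\})$ and $f'_{(\chi,\eta)}$ has two distinct roots of multiplicity $1$ in $(b,\infty)$ and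 no other roots in $(b,\infty)$. Moreover, the map $W_{\mathcal{O}}:\mathcal{O}\to\angle$ which sends each $(\chi,\eta)$ to the pair $(t,s)$, $t>s$, of roots of $f'_{(\chi,\eta)}$ in $(b,\infty)$ is a homeomorphism, and its inverse $(t,s)\mapsto(\chi_{\mathcal{O}}(t,s),\eta_{\mathcal{O}}(t,s))$ is given by $$\chi_{\mathcal{O}}(t,s)=\frac{tC(t)-sC(s)}{C(t)-C(s)},\qquad \eta_{\mathcal{O}}(t,s)=1+\frac{C(t)C(s)(t-s)}{C(t)-C(s)},$$ where $C(t)-C(s)\neq0$ for all $(t,s)\in\angle$. -/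

import Mathlib

open MeasureTheory Set

/-- The Cauchy transform `C(w) = ∫ μ[dx] / (w - x)` of a measure `μ` on `ℝ`. -/
noncomputable def cauchyTransform (μ : Measure ℝ) (w : ℂ) : ℂ :=
  ∫ x : ℝ, 1 / (w - (x : ℂ)) ∂μ

/-- The function `f_{(χ,η)}(w) = ∫ log (w - x) μ[dx] - (1 - η) log (w - χ)`, with `p = (χ, η)` and
with `log` the principal branch. If `μ` is carried by `[a, b]` and `χ ≤ b`, the integrals make
sense and define an analytic function on the whole of `(ℂ \ ℝ) ∪ (b, ∞)`. -/
noncomputable def steepestFun (μ : Measure ℝ) (p : ℝ × ℝ) (w : ℂ) : ℂ :=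
  (∫ x : ℝ, Complex.log (w - (x : ℂ)) ∂μ) - (1 - (p.2 : ℂ)) * Complex.log (w - (p.1 : ℂ))

/-- The derivative `f'_{(χ,η)}`, with `p = (χ, η)`. -/
noncomputable def steepestDeriv (μ : Measure ℝ) (p : ℝ × ℝ) : ℂ → ℂ :=
  deriv (steepestFun μ p)

/-- The set `𝒪` of all `(χ, η) ∈ [a, b] × [0, 1]` with `χ < b` and `η > 0` for which `f'_{(χ,η)}`
has a root of multiplicity `1` in `(b, ∞)`. -/
def lowRig (μ : Measure ℝ) (a b : ℝ) : Set (ℝ × ℝ) :=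
  {p | p ∈ Icc a b ×ˢ Icc (0 : ℝ) 1 ∧ p.1 < b ∧ 0 < p.2 ∧
    ∃ t : ℝ, b < t ∧ analyticOrderAt (steepestDeriv μ p) (t : ℂ) = 1}

/-- The set of roots of `f'_{(χ,η)}` in `(b, ∞)`, with `p = (χ, η)`. -/
def rootSetAbove (μ : Measure ℝ) (b : ℝ) (p : ℝ × ℝ) : Set ℝ :=
  {t | b < t ∧ steepestDeriv μ p (t : ℂ) = 0}

/-- `t` and `s` are roots of `f'_{(χ,η)}` of multiplicity `1`, and they are precisely the roots of
`f'_{(χ,η)}` in `(b, ∞)`. -/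
def IsSimpleRootPair (μ : Measure ℝ) (b : ℝ) (p : ℝ × ℝ) (t s : ℝ) : Prop :=
  rootSetAbove μ b p = {t, s} ∧
    analyticOrderAt (steepestDeriv μ p) (t : ℂ) = 1 ∧
    analyticOrderAt (steepestDeriv μ p) (s : ℂ) = 1

/-- The wedge `∠ = {(t, s) ∈ (b, ∞)² : t > s}`. -/
def wedge (b : ℝ) : Set (ℝ × ℝ) :=
  {q | q ∈ Ioi b ×ˢ Ioi b ∧ q.2 < q.1}

/-! On `(b, ∞)` write `f' = g / (w - χ)` with `g(w) = (w - χ) C(w) - (1 - η)`. As `w - χ > 0` there,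
roots of `f'` and their simplicity are those of the real function `g`
(`analyticOrderAt_steepestDeriv_eq_one_iff`).

The main tool is positivity of `∫ (x - χ)² / D(x) μ(dx)`, where `D` is a product of factors such as
`s - x`, `t - x`, `w - x`; it is strict because `χ < b` and `b` lies in the support. If `g(s) = g(t)
= 0`, partial fractions turn these integrals into identities: `η = ∫ (x - χ)² / ((s - x)(t - x))
μ(dx)` and `(w - χ) g(w) = (w - s)(w - t) ∫ (x - χ)² / ((s - x)(t - x)(w - x)) μ(dx)`. So two roots
force `η > 0`, exclude a third and fix the sign of `g` everywhere (`rootFun_mul_pos`). The variant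
with `(s - x)²` excludes a double root (`rootFunDeriv_ne_zero`).

Conversely, `g` changes sign at a simple root, while it is positive close to `b` (because of the
atom) and far out (because `η > 0`); the intermediate value theorem gives a second root
(`exists_isRootPair`).

Finally, `g(s) = g(t) = 0` is a linear system in `(χ, η)`, whose solution is the stated inverse. The
roots depend continuously on the parameters because strict signs of `g` at points around them
persist (`eventually_dist_lt`). -/

/-- A function that is continuous on `[a, b]` is integrable for a finite measure carried by
`[a, b]`. -/
lemma integrable_of_continuousOn_Icc {E : Type*} [NormedAddCommGroup E]
    {μ : Measure ℝ} [IsFiniteMeasure μ] {a b : ℝ} (hμ : ∀ᵐ x ∂μ, x ∈ Icc a b) {f : ℝ → E}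
    (hf : ContinuousOn f (Icc a b)) : Integrable f μ := by
  have h : IntegrableOn f (Icc a b) μ := hf.integrableOn_Icc
  rwa [IntegrableOn, Measure.restrict_eq_self_of_ae_mem hμ] at h

lemma ae_mem_Icc_of_support_subset {μ : Measure ℝ} {a b : ℝ} (hsupp : μ.support ⊆ Icc a b) :
    ∀ᵐ x ∂μ, x ∈ Icc a b :=
  Filter.mem_of_superset (Measure.support_mem_ae (μ := μ)) hsupp

/-! ### Differentiation of the logarithmic potential and the Cauchy transform -/

/-- Differentiation under the integral sign for a kernel that depends on `w - x` and is
differentiable in the right half-plane. -/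
lemma hasDerivAt_integral_sub {μ : Measure ℝ} [IsFiniteMeasure μ] {a b : ℝ}
    (hμ : ∀ᵐ x ∂μ, x ∈ Icc a b) {k k' : ℂ → ℂ} (hk : ∀ z : ℂ, 0 < z.re → HasDerivAt k (k' z) z)
    (hk' : ContinuousOn k' {z | 0 < z.re}) (B : ℝ → ℝ)
    (hB : ∀ δ > 0, ∀ z : ℂ, δ ≤ z.re → ‖k' z‖ ≤ B δ) {w : ℂ} (hw : b < w.re) :
    HasDerivAt (fun w : ℂ => ∫ x : ℝ, k (w - x) ∂μ) (∫ x : ℝ, k' (w - x) ∂μ) w := by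
  have hkc : ContinuousOn k {z | 0 < z.re} := fun z hz => (hk z hz).continuousAt.continuousWithinAt
  have hcont : ∀ {φ : ℂ → ℂ}, ContinuousOn φ {z | 0 < z.re} → ∀ v : ℂ, b < v.re →
      Integrable (fun x : ℝ => φ (v - x)) μ := by
    intro φ hφ v hv
    refine integrable_of_continuousOn_Icc hμ (hφ.comp (by fun_prop) ?_)
    intro x hx
    change 0 < (v - x : ℂ).re
    simp only [Complex.sub_re, Complex.ofReal_re]
    linarith [hx.2]
  -- Halfway between `b` and `Re w`: for `Re v > c` and `x ≤ b` one has `Re (v - x) ≥ c - b > 0`, so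
  -- the constant `B (c - b)` dominates.
  set c : ℝ := (b + w.re) / 2 with hc
  have hs : {v : ℂ | c < v.re} ∈ nhds w :=
    (isOpen_lt continuous_const Complex.continuous_re).mem_nhds (show c < w.re by linarith)
  refine (hasDerivAt_integral_of_dominated_loc_of_deriv_le (μ := μ)
    (F := fun (v : ℂ) (x : ℝ) => k (v - x)) (F' := fun (v : ℂ) (x : ℝ) => k' (v - x))
    (bound := fun _ => B (c - b)) hs ?_ (hcont hkc w hw) (hcont hk' w hw).aestronglyMeasurable ?_
    (integrable_const _) ?_).2
  · filter_upwards [hs] with v hv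
    replace hv : c < v.re := hv
    exact (hcont hkc v (by linarith)).aestronglyMeasurable
  · filter_upwards [hμ] with x hx v hv
    replace hv : c < v.re := hv
    refine hB _ (by linarith) _ ?_
    simp only [Complex.sub_re, Complex.ofReal_re]
    linarith [hx.2]
  · filter_upwards [hμ] with x hx v hv
    replace hv : c < v.re := hv
    have := hk (v - x) (by simp only [Complex.sub_re, Complex.ofReal_re]; linarith [hx.2])
    exact this.comp_sub_const v (x : ℂ)

lemma ne_zero_of_re_pos {z : ℂ} (hz : 0 < z.re) : z ≠ 0 := by
  rintro rfl
  simp at hz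

lemma hasDerivAt_integral_log_sub {μ : Measure ℝ} [IsFiniteMeasure μ] {a b : ℝ}
    (hμ : ∀ᵐ x ∂μ, x ∈ Icc a b) {w : ℂ} (hw : b < w.re) :
    HasDerivAt (fun w : ℂ => ∫ x : ℝ, Complex.log (w - x) ∂μ) (cauchyTransform μ w) w := by
  refine hasDerivAt_integral_sub (k' := fun z => 1 / z) hμ ?_ ?_ (fun δ => 1 / δ) ?_ hw
  · intro z hz
    simpa using Complex.hasDerivAt_log (Or.inl hz)
  · exact continuousOn_const.div continuousOn_id fun z hz => ne_zero_of_re_pos hz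
  · intro δ hδ z hz
    rw [norm_div, norm_one]
    gcongr
    exact hz.trans (Complex.re_le_norm z)

lemma hasDerivAt_cauchyTransform {μ : Measure ℝ} [IsFiniteMeasure μ] {a b : ℝ}
    (hμ : ∀ᵐ x ∂μ, x ∈ Icc a b) {w : ℂ} (hw : b < w.re) :
    HasDerivAt (cauchyTransform μ) (∫ x : ℝ, -(1 / (w - x) ^ 2) ∂μ) w := by
  refine hasDerivAt_integral_sub (k := fun z => 1 / z) (k' := fun z => -(1 / z ^ 2)) hμ ?_ ?_
    (fun δ => 1 / δ ^ 2) ?_ hw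
  · intro z hz
    simpa using hasDerivAt_inv (ne_zero_of_re_pos hz)
  · exact (continuousOn_const.div (continuousOn_id.pow 2)
      fun z hz => pow_ne_zero 2 (ne_zero_of_re_pos hz)).neg
  · intro δ hδ z hz
    rw [norm_neg, norm_div, norm_one, norm_pow]
    gcongr
    exact hz.trans (Complex.re_le_norm z)

/-! ### Reduction to a real function on the half-line -/

/-- The Cauchy transform as a real function on the real line. -/
noncomputable def realCauchy (μ : Measure ℝ) (w : ℝ) : ℝ := ∫ x, 1 / (w - x) ∂μ

/-- Minus the derivative of the Cauchy transform as a real function on the real line. -/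
noncomputable def realCauchySq (μ : Measure ℝ) (w : ℝ) : ℝ := ∫ x, 1 / (w - x) ^ 2 ∂μ

lemma cauchyTransform_ofReal (μ : Measure ℝ) (w : ℝ) :
    cauchyTransform μ w = (realCauchy μ w : ℂ) := by
  rw [cauchyTransform, realCauchy, ← integral_complex_ofReal]
  simp

/-- The function `(w - χ) f'_{(χ,η)}(w)` on the real line. -/
noncomputable def rootFun (μ : Measure ℝ) (p : ℝ × ℝ) (w : ℝ) : ℝ :=
  (w - p.1) * realCauchy μ w - (1 - p.2)

/-- The derivative of `rootFun` in `w`. -/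
noncomputable def rootFunDeriv (μ : Measure ℝ) (p : ℝ × ℝ) (w : ℝ) : ℝ :=
  realCauchy μ w - (w - p.1) * realCauchySq μ w

lemma hasDerivAt_cauchyTransform_ofReal {μ : Measure ℝ} [IsFiniteMeasure μ] {a b : ℝ}
    (hμ : ∀ᵐ x ∂μ, x ∈ Icc a b) {w : ℝ} (hw : b < w) :
    HasDerivAt (cauchyTransform μ) (((-realCauchySq μ w : ℝ)) : ℂ) w := by
  convert hasDerivAt_cauchyTransform hμ (w := w) (by simpa using hw) using 1
  rw [realCauchySq, ← integral_neg, ← integral_complex_ofReal]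
  simp

lemma hasDerivAt_realCauchy {μ : Measure ℝ} [IsFiniteMeasure μ] {a b : ℝ}
    (hμ : ∀ᵐ x ∂μ, x ∈ Icc a b) {w : ℝ} (hw : b < w) :
    HasDerivAt (realCauchy μ) (-realCauchySq μ w) w := by
  simpa only [cauchyTransform_ofReal, Complex.ofReal_re] using (hasDerivAt_cauchyTransform_ofReal hμ hw).real_of_complex

lemma hasDerivAt_rootFun {μ : Measure ℝ} [IsFiniteMeasure μ] {a b : ℝ}
    (hμ : ∀ᵐ x ∂μ, x ∈ Icc a b) (p : ℝ × ℝ) {w : ℝ} (hw : b < w) :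
    HasDerivAt (rootFun μ p) (rootFunDeriv μ p w) w := by
  have h := ((((hasDerivAt_id w).sub_const p.1).mul (hasDerivAt_realCauchy hμ hw)).sub_const
    (1 - p.2))
  exact (show HasDerivAt (rootFun μ p) _ w from h).congr_deriv
    (by simp only [rootFunDeriv, id]; ring)

lemma steepestDeriv_eq {μ : Measure ℝ} [IsFiniteMeasure μ] {a b : ℝ}
    (hμ : ∀ᵐ x ∂μ, x ∈ Icc a b) {p : ℝ × ℝ} (hp : p.1 < b) {w : ℂ} (hw : b < w.re) :
    steepestDeriv μ p w = cauchyTransform μ w - (1 - (p.2 : ℂ)) / (w - p.1) := by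
  have h1 : HasDerivAt (fun w : ℂ => Complex.log (w - (p.1 : ℂ))) (1 / (w - p.1)) w :=
    ((hasDerivAt_id w).sub_const (p.1 : ℂ)).clog (Or.inl (by simp; linarith))
  have h := (hasDerivAt_integral_log_sub hμ hw).sub (h1.const_mul (1 - (p.2 : ℂ)))
  rw [steepestDeriv]
  refine Eq.trans h.deriv ?_
  ring

section
variable {μ : Measure ℝ} [IsFiniteMeasure μ] {a b : ℝ} (hμ : ∀ᵐ x ∂μ, x ∈ Icc a b)
  {p : ℝ × ℝ} (hp : p.1 < b) {w : ℝ} (hw : b < w)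
include hμ hp hw

lemma steepestDeriv_ofReal :
    steepestDeriv μ p w = ((rootFun μ p w / (w - p.1) : ℝ) : ℂ) := by
  have h : ((w : ℂ) - p.1) ≠ 0 := by
    rw [← Complex.ofReal_sub]
    exact_mod_cast (sub_pos.2 (hp.trans hw)).ne'
  rw [steepestDeriv_eq hμ hp (by simpa using hw), cauchyTransform_ofReal, rootFun]
  push_cast
  field_simp

lemma steepestDeriv_eq_zero_iff : steepestDeriv μ p w = 0 ↔ rootFun μ p w = 0 := by
  rw [steepestDeriv_ofReal hμ hp hw, Complex.ofReal_eq_zero, div_eq_zero_iff]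
  have : w - p.1 ≠ 0 := (sub_pos.2 (hp.trans hw)).ne'
  tauto

lemma analyticAt_steepestDeriv : AnalyticAt ℂ (steepestDeriv μ p) w := by
  have hopen : IsOpen {v : ℂ | b < v.re} := isOpen_lt continuous_const Complex.continuous_re
  have hd : DifferentiableOn ℂ (steepestFun μ p) {v : ℂ | b < v.re} := by
    intro v (hv : b < v.re)
    have h1 : HasDerivAt (fun w : ℂ => Complex.log (w - (p.1 : ℂ))) (1 / (v - p.1)) v :=
      ((hasDerivAt_id v).sub_const (p.1 : ℂ)).clog
        (Or.inl (by simp only [id, Complex.sub_re, Complex.ofReal_re]; linarith))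
    exact ((hasDerivAt_integral_log_sub hμ hv).sub
      (h1.const_mul (1 - (p.2 : ℂ)))).differentiableAt.differentiableWithinAt
  exact (hd.analyticAt (hopen.mem_nhds (by simpa using hw))).deriv

/-- In the quotient rule for `rootFun / (w - χ)`, the term containing `rootFun` itself vanishes at a
root. -/
lemma deriv_steepestDeriv (h0 : rootFun μ p w = 0) :
    deriv (steepestDeriv μ p) w = ((rootFunDeriv μ p w / (w - p.1) : ℝ) : ℂ) := by
  have hne : w - p.1 ≠ 0 := (sub_pos.2 (hp.trans hw)).ne'
  have hC : realCauchy μ w * (w - p.1) = 1 - p.2 := by rw [rootFun] at h0; linarith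
  have hneC : ((w : ℂ) - p.1) ≠ 0 := by rw [← Complex.ofReal_sub]; exact_mod_cast hne
  have hopen : IsOpen {v : ℂ | b < v.re} := isOpen_lt continuous_const Complex.continuous_re
  have heq : steepestDeriv μ p =ᶠ[nhds (w : ℂ)]
      fun v => cauchyTransform μ v - (1 - (p.2 : ℂ)) / (v - p.1) := by
    filter_upwards [hopen.mem_nhds (show (w : ℂ) ∈ _ by simpa using hw)] with v hv
    exact steepestDeriv_eq hμ hp hv
  have h := (hasDerivAt_cauchyTransform_ofReal hμ hw).sub
    ((hasDerivAt_const (w : ℂ) (1 - (p.2 : ℂ))).div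
      ((hasDerivAt_id (w : ℂ)).sub_const (p.1 : ℂ)) hneC)
  have hC' : (1 - (p.2 : ℂ)) = realCauchy μ w * (w - p.1) := by exact_mod_cast hC.symm
  rw [heq.deriv_eq]
  refine Eq.trans h.deriv ?_
  rw [rootFunDeriv, hC']
  push_cast
  simp only [id]
  field_simp
  ring

lemma analyticOrderAt_steepestDeriv_eq_one_iff :
    analyticOrderAt (steepestDeriv μ p) w = 1 ↔ rootFun μ p w = 0 ∧ rootFunDeriv μ p w ≠ 0 := by
  have hne : w - p.1 ≠ 0 := (sub_pos.2 (hp.trans hw)).ne'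
  have h := analyticOrderAt_eq_nat_iff_iteratedDeriv_eq_zero
    (analyticAt_steepestDeriv hμ hp hw) (n := 1)
  simp only [Nat.cast_one, Nat.lt_one_iff, forall_eq, iteratedDeriv_zero, iteratedDeriv_one,
    steepestDeriv_eq_zero_iff hμ hp hw] at h
  rw [h]
  refine and_congr_right fun h0 => ?_
  rw [deriv_steepestDeriv hμ hp hw h0, Ne, Complex.ofReal_eq_zero, div_eq_zero_iff]
  tauto

end

/-! ### Positive integrals, partial fractions and lower bounds for the Cauchy transform -/

/-- A function that is continuous and nonnegative on `[a, b]` and positive at a point of the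
support of a finite measure carried by `[a, b]` has positive integral. -/
lemma integral_pos_of_mem_support {μ : Measure ℝ} [IsFiniteMeasure μ] {a b : ℝ}
    (hμ : ∀ᵐ x ∂μ, x ∈ Icc a b) {f : ℝ → ℝ} (hf : ContinuousOn f (Icc a b))
    (h0 : ∀ x ∈ Icc a b, 0 ≤ f x) {c : ℝ} (hc : c ∈ μ.support) (hcI : c ∈ Icc a b)
    (hfc : 0 < f c) : 0 < ∫ x, f x ∂μ := by
  have hae : 0 ≤ᵐ[μ] f := by
    filter_upwards [hμ] with x hx using h0 x hx
  rw [integral_pos_iff_support_of_nonneg_ae hae (integrable_of_continuousOn_Icc hμ hf)]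
  have hU : {x | x ∈ Icc a b → 0 < f x} ∈ nhds c :=
    eventually_nhdsWithin_iff.1 ((hf c hcI).eventually (lt_mem_nhds hfc))
  refine lt_of_lt_of_le (Measure.mem_support_iff_forall c |>.1 hc _ hU) (measure_mono_ae ?_)
  filter_upwards [hμ] with x hx hxU
  exact (hxU hx).ne'

lemma integral_linear_combination_three {α : Type*} [MeasurableSpace α] {μ : Measure α}
    {f g h : α → ℝ} (hf : Integrable f μ) (hg : Integrable g μ) (hh : Integrable h μ)
    (k l m : ℝ) :
    ∫ x, (k * f x + (l * g x + m * h x)) ∂μ =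
      k * ∫ x, f x ∂μ + (l * ∫ x, g x ∂μ + m * ∫ x, h x ∂μ) := by
  have hgh : Integrable (fun x => l * g x + m * h x) μ := (hg.const_mul l).add (hh.const_mul m)
  rw [integral_add (hf.const_mul k) hgh, integral_add (hg.const_mul l) (hh.const_mul m),
    integral_const_mul, integral_const_mul, integral_const_mul]

section
variable {μ : Measure ℝ} [IsProbabilityMeasure μ] {a b : ℝ} (hμ : ∀ᵐ x ∂μ, x ∈ Icc a b)

lemma continuousOn_one_div_sub {w : ℝ} (hw : b < w) :
    ContinuousOn (fun x : ℝ => 1 / (w - x)) (Icc a b) :=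
  continuousOn_const.div (by fun_prop) fun x hx => (sub_pos.2 (hx.2.trans_lt hw)).ne'

include hμ

lemma integrable_one_div_sub {w : ℝ} (hw : b < w) : Integrable (fun x : ℝ => 1 / (w - x)) μ :=
  integrable_of_continuousOn_Icc hμ (continuousOn_one_div_sub hw)

lemma integrable_one_div_sub_sq {w : ℝ} (hw : b < w) :
    Integrable (fun x : ℝ => 1 / (w - x) ^ 2) μ := by
  refine integrable_of_continuousOn_Icc hμ (((continuousOn_one_div_sub hw).pow 2).congr ?_)
  intro x _
  simp

/-- Partial fractions in `x`. Numerator and denominator have equal degree, whence the polynomial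
part `1`, which integrates to the total mass. -/
lemma integral_sq_div_mul {s t : ℝ} (hs : b < s) (ht : b < t) (hst : s ≠ t) (χ : ℝ) :
    ∫ x, (x - χ) ^ 2 / ((s - x) * (t - x)) ∂μ =
      1 + ((s - χ) ^ 2 / (t - s) * realCauchy μ s + (t - χ) ^ 2 / (s - t) * realCauchy μ t) := by
  have h1 := sub_ne_zero.2 hst
  have h2 := sub_ne_zero.2 hst.symm
  calc _ = ∫ x, (1 * 1 + ((s - χ) ^ 2 / (t - s) * (1 / (s - x)) +
        (t - χ) ^ 2 / (s - t) * (1 / (t - x)))) ∂μ := by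
        refine integral_congr_ae ?_
        filter_upwards [hμ] with x hx
        have h3 : s - x ≠ 0 := (sub_pos.2 (hx.2.trans_lt hs)).ne'
        have h4 : t - x ≠ 0 := (sub_pos.2 (hx.2.trans_lt ht)).ne'
        rw [← neg_sub t s]
        field_simp
        ring
    _ = _ := by
        rw [integral_linear_combination_three (integrable_const 1) (integrable_one_div_sub hμ hs)
          (integrable_one_div_sub hμ ht)]
        simp [realCauchy]

lemma integral_sq_div_mul_mul {s t w : ℝ} (hs : b < s) (ht : b < t) (hw : b < w) (hst : s ≠ t)
    (hsw : s ≠ w) (htw : t ≠ w) (χ : ℝ) :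
    ∫ x, (x - χ) ^ 2 / ((s - x) * (t - x) * (w - x)) ∂μ =
      (s - χ) ^ 2 / ((t - s) * (w - s)) * realCauchy μ s +
        ((t - χ) ^ 2 / ((s - t) * (w - t)) * realCauchy μ t +
          (w - χ) ^ 2 / ((s - w) * (t - w)) * realCauchy μ w) := by
  have h1 := sub_ne_zero.2 hst.symm
  have h2 := sub_ne_zero.2 hsw.symm
  have h3 := sub_ne_zero.2 htw.symm
  calc _ = ∫ x, ((s - χ) ^ 2 / ((t - s) * (w - s)) * (1 / (s - x)) +
        ((t - χ) ^ 2 / ((s - t) * (w - t)) * (1 / (t - x)) +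
          (w - χ) ^ 2 / ((s - w) * (t - w)) * (1 / (w - x)))) ∂μ := by
        refine integral_congr_ae ?_
        filter_upwards [hμ] with x hx
        have h4 : s - x ≠ 0 := (sub_pos.2 (hx.2.trans_lt hs)).ne'
        have h5 : t - x ≠ 0 := (sub_pos.2 (hx.2.trans_lt ht)).ne'
        have h6 : w - x ≠ 0 := (sub_pos.2 (hx.2.trans_lt hw)).ne'
        rw [← neg_sub t s, ← neg_sub w s, ← neg_sub w t]
        field_simp
        ring
    _ = _ := by
        rw [integral_linear_combination_three (integrable_one_div_sub hμ hs)
          (integrable_one_div_sub hμ ht) (integrable_one_div_sub hμ hw)]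
        rfl

/-- The confluent form of the three-point expansion, with two of the poles merged at `s`; this
brings in the derivative of `C`. -/
lemma integral_sq_div_sq_mul {s t : ℝ} (hs : b < s) (ht : b < t) (hst : s ≠ t) (χ : ℝ) :
    ∫ x, (x - χ) ^ 2 / ((s - x) ^ 2 * (t - x)) ∂μ =
      (s - χ) ^ 2 / (t - s) * realCauchySq μ s +
        ((-2 * (s - χ) / (t - s) - (s - χ) ^ 2 / (t - s) ^ 2) * realCauchy μ s +
          (t - χ) ^ 2 / (t - s) ^ 2 * realCauchy μ t) := by
  have h1 := sub_ne_zero.2 hst.symm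
  calc _ = ∫ x, ((s - χ) ^ 2 / (t - s) * (1 / (s - x) ^ 2) +
        ((-2 * (s - χ) / (t - s) - (s - χ) ^ 2 / (t - s) ^ 2) * (1 / (s - x)) +
          (t - χ) ^ 2 / (t - s) ^ 2 * (1 / (t - x)))) ∂μ := by
        refine integral_congr_ae ?_
        filter_upwards [hμ] with x hx
        have h4 : s - x ≠ 0 := (sub_pos.2 (hx.2.trans_lt hs)).ne'
        have h5 : t - x ≠ 0 := (sub_pos.2 (hx.2.trans_lt ht)).ne'
        field_simp
        ring
    _ = _ := by
        rw [integral_linear_combination_three (integrable_one_div_sub_sq hμ hs)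
          (integrable_one_div_sub hμ hs) (integrable_one_div_sub hμ ht)]
        rfl

lemma one_div_sub_le_realCauchy {w : ℝ} (hw : b < w) : 1 / (w - a) ≤ realCauchy μ w := by
  have h : ∫ _, 1 / (w - a) ∂μ ≤ ∫ x, 1 / (w - x) ∂μ := by
    refine integral_mono_ae (integrable_const _) (integrable_one_div_sub hμ hw) ?_
    filter_upwards [hμ] with x hx
    exact one_div_le_one_div_of_le (by linarith [hx.2]) (by linarith [hx.1])
  simpa [realCauchy] using h

lemma realCauchy_pos (hab : a < b) {w : ℝ} (hw : b < w) : 0 < realCauchy μ w :=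
  lt_of_lt_of_le (one_div_pos.2 (by linarith)) (one_div_sub_le_realCauchy hμ hw)

/-- The positive kernel `1 / (w - x)` dominates its restriction to the two distinct points `c` and
`b`. -/
lemma atoms_le_realCauchy {c w : ℝ} (hc : c < b) (hw : b < w) :
    μ.real {c} / (w - c) + μ.real {b} / (w - b) ≤ realCauchy μ w := by
  have i : ∀ y k : ℝ, Integrable (({y} : Set ℝ).indicator fun _ => k) μ := fun y k =>
    (integrable_const k).indicator (measurableSet_singleton y)
  have h : ∫ x, (({c} : Set ℝ).indicator (fun _ => 1 / (w - c)) x +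
      ({b} : Set ℝ).indicator (fun _ => 1 / (w - b)) x) ∂μ ≤ ∫ x, 1 / (w - x) ∂μ := by
    refine integral_mono_ae ((i _ _).add (i _ _)) (integrable_one_div_sub hμ hw) ?_
    filter_upwards [hμ] with x hx
    have hx0 : 0 < 1 / (w - x) := one_div_pos.2 (by linarith [hx.2])
    by_cases h1 : x = c
    · simp [h1, hc.ne]
    · by_cases h2 : x = b
      · simp [h2, hc.ne']
      · simpa [h1, h2] using hx0.le
  rw [integral_add (i _ _) (i _ _), integral_indicator_const _ (measurableSet_singleton c),
    integral_indicator_const _ (measurableSet_singleton b)] at h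
  simpa [realCauchy, div_eq_mul_inv] using h

end

/-! ### Pairs of roots: sign pattern, simplicity and recovery of the parameters -/

/-- `χ < b` and `s < t` are roots of `f'_{(χ,η)}` in `(b, ∞)`. -/
structure IsRootPair (μ : Measure ℝ) (b : ℝ) (p : ℝ × ℝ) (t s : ℝ) : Prop where
  fst_lt : p.1 < b
  lt_right : b < s
  lt : s < t
  left_root : rootFun μ p t = 0
  right_root : rootFun μ p s = 0

/-- The pair `(χ, η)` for which `f'_{(χ,η)}` has the given roots. -/
noncomputable def paramOfRoots (μ : Measure ℝ) (q : ℝ × ℝ) : ℝ × ℝ :=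
  ((q.1 * realCauchy μ q.1 - q.2 * realCauchy μ q.2) / (realCauchy μ q.1 - realCauchy μ q.2),
    1 + realCauchy μ q.1 * realCauchy μ q.2 * (q.1 - q.2) /
      (realCauchy μ q.1 - realCauchy μ q.2))

section
variable {μ : Measure ℝ} [IsProbabilityMeasure μ] {a b : ℝ} (hμ : ∀ᵐ x ∂μ, x ∈ Icc a b)
  (hab : a < b) (hb : b ∈ μ.support) {p : ℝ × ℝ} {s t : ℝ}
include hμ hab

lemma realCauchy_sub_neg (hb : b ∈ μ.support) (hs : b < s) (hst : s < t) :
    realCauchy μ t - realCauchy μ s < 0 := by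
  have hpos : 0 < ∫ x, (1 / (s - x) - 1 / (t - x)) ∂μ := by
    have hlt : ∀ x ∈ Icc a b, 1 / (t - x) < 1 / (s - x) := fun x hx =>
      one_div_lt_one_div_of_lt (by linarith [hx.2]) (by linarith)
    exact integral_pos_of_mem_support hμ
      ((continuousOn_one_div_sub hs).sub (continuousOn_one_div_sub (hs.trans hst)))
      (fun x hx => sub_nonneg.2 (hlt x hx).le) hb (right_mem_Icc.2 hab.le)
      (sub_pos.2 (hlt b (right_mem_Icc.2 hab.le)))
  rw [integral_sub (integrable_one_div_sub hμ hs) (integrable_one_div_sub hμ (hs.trans hst))]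
    at hpos
  change 0 < realCauchy μ s - realCauchy μ t at hpos
  linarith

/-- The difference is the integral of `(t - s)(b - x) / ((t - x)(s - x))`, which is nonnegative and
positive at `a`. It yields `χ < b` in `isRootPair_paramOfRoots`. -/
lemma sub_mul_realCauchy_lt (ha : a ∈ μ.support) (hs : b < s) (hst : s < t) :
    (s - b) * realCauchy μ s < (t - b) * realCauchy μ t := by
  have hpos : 0 < ∫ x, ((t - b) * (1 / (t - x)) - (s - b) * (1 / (s - x))) ∂μ := by
    have heq : ∀ x ∈ Icc a b, (t - b) * (1 / (t - x)) - (s - b) * (1 / (s - x)) =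
        (t - s) * (b - x) / ((t - x) * (s - x)) := fun x hx => by
      have h1 : s - x ≠ 0 := (sub_pos.2 (hx.2.trans_lt hs)).ne'
      have h2 : t - x ≠ 0 := (sub_pos.2 (hx.2.trans_lt (hs.trans hst))).ne'
      field_simp
      ring
    refine integral_pos_of_mem_support hμ
      ((continuousOn_const.mul (continuousOn_one_div_sub (hs.trans hst))).sub
        (continuousOn_const.mul (continuousOn_one_div_sub hs))) (fun x hx => ?_) ha
      (left_mem_Icc.2 hab.le) ?_
    · rw [heq x hx]
      exact div_nonneg (mul_nonneg (by linarith) (by linarith [hx.2]))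
        (mul_nonneg (by linarith [hx.2]) (by linarith [hx.2]))
    · rw [heq a (left_mem_Icc.2 hab.le)]
      exact div_pos (mul_pos (by linarith) (by linarith)) (mul_pos (by linarith) (by linarith))
  rw [integral_sub ((integrable_one_div_sub hμ (hs.trans hst)).const_mul _)
    ((integrable_one_div_sub hμ hs).const_mul _), integral_const_mul, integral_const_mul] at hpos
  change 0 < (t - b) * realCauchy μ t - (s - b) * realCauchy μ s at hpos
  linarith

include hb

/-- Positivity of the integral of `(x - χ)² / D(x)`, for `χ < b` and `D` positive on `[a, b]`. -/
lemma integral_sq_div_pos {χ : ℝ} (hχ : χ < b) {D : ℝ → ℝ} (hD : Continuous D)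
    (hpos : ∀ x ≤ b, 0 < D x) : 0 < ∫ x, (x - χ) ^ 2 / D x ∂μ := by
  refine integral_pos_of_mem_support hμ
    (ContinuousOn.div (by fun_prop) hD.continuousOn fun x hx => (hpos x hx.2).ne')
    (fun x hx => div_nonneg (sq_nonneg _) (hpos x hx.2).le) hb (right_mem_Icc.2 hab.le) ?_
  exact div_pos (pow_pos (sub_pos.2 hχ) 2) (hpos b le_rfl)

/-- A double root at `s` together with a root at `t` would make the positive integral of `(x - χ)² /
((s - x)² (t - x))` vanish. The order of `s` and `t` is immaterial. -/
lemma rootFunDeriv_ne_zero (hχ : p.1 < b) (hs : b < s) (ht : b < t) (hst : s ≠ t)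
    (h1 : rootFun μ p s = 0) (h2 : rootFun μ p t = 0) : rootFunDeriv μ p s ≠ 0 := by
  intro h0
  have hpos := integral_sq_div_pos hμ hab hb hχ (D := fun x => (s - x) ^ 2 * (t - x))
    (by fun_prop) fun x hx => mul_pos (pow_pos (by linarith) 2) (by linarith)
  have hts := sub_ne_zero.2 hst.symm
  rw [integral_sq_div_sq_mul hμ hs ht hst] at hpos
  rw [rootFun] at h1 h2
  rw [rootFunDeriv] at h0
  refine hpos.ne' ?_
  have e2 : (t - p.1) * realCauchy μ t = (s - p.1) * realCauchy μ s := by linarith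
  have e3 : realCauchy μ s = (s - p.1) * realCauchySq μ s := by linarith
  field_simp
  linear_combination (t - p.1) * e2 - (t - s) * (s - p.1) * e3

namespace IsRootPair

variable (h : IsRootPair μ b p t s)
include h

/-- Substituting `(s - χ) C(s) = (t - χ) C(t) = 1 - η` in `integral_sq_div_mul` shows that the
integral equals `η`. -/
lemma snd_pos : 0 < p.2 := by
  have hpos := integral_sq_div_pos hμ hab hb h.fst_lt (D := fun x => (s - x) * (t - x))
    (by fun_prop) fun x hx => mul_pos (by linarith [h.lt_right]) (by linarith [h.lt_right, h.lt])
  rw [integral_sq_div_mul hμ h.lt_right (h.lt_right.trans h.lt) h.lt.ne] at hpos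
  have h1 := h.right_root
  have h2 := h.left_root
  rw [rootFun] at h1 h2
  have e1 : (s - p.1) * realCauchy μ s = 1 - p.2 := by linarith
  have e2 : (t - p.1) * realCauchy μ t = 1 - p.2 := by linarith
  have hts := sub_ne_zero.2 h.lt.ne'
  convert hpos using 1
  rw [← neg_sub t s]
  field_simp
  linear_combination (p.1 - s) * e1 + (t - p.1) * e2

lemma rootFun_mul_pos {w : ℝ} (hw : b < w) (hws : w ≠ s) (hwt : w ≠ t) :
    0 < rootFun μ p w * ((w - s) * (w - t)) := by
  have hpos := integral_sq_div_pos hμ hab hb h.fst_lt (D := fun x => (s - x) * (t - x) * (w - x))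
    (by fun_prop) fun x hx => mul_pos (mul_pos (by linarith [h.lt_right])
      (by linarith [h.lt_right, h.lt])) (by linarith)
  rw [integral_sq_div_mul_mul hμ h.lt_right (h.lt_right.trans h.lt) hw h.lt.ne hws.symm hwt.symm]
    at hpos
  have h1 := h.right_root
  have h2 := h.left_root
  rw [rootFun] at h1 h2
  have e1 : (s - p.1) * realCauchy μ s = 1 - p.2 := by linarith
  have e2 : (t - p.1) * realCauchy μ t = 1 - p.2 := by linarith
  have hts := sub_ne_zero.2 h.lt.ne'
  have hws' := sub_ne_zero.2 hws
  have hwt' := sub_ne_zero.2 hwt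
  have hwp : 0 < w - p.1 := by linarith [h.fst_lt]
  -- The integral equals `(w - χ) g(w) / ((w - s)(w - t))`; multiplying by the square of the
  -- denominator preserves its sign.
  have key : rootFun μ p w * ((w - s) * (w - t)) * (w - p.1) =
      ((s - p.1) ^ 2 / ((t - s) * (w - s)) * realCauchy μ s +
        ((t - p.1) ^ 2 / ((s - t) * (w - t)) * realCauchy μ t +
          (w - p.1) ^ 2 / ((s - w) * (t - w)) * realCauchy μ w)) *
        ((w - s) * (w - t)) ^ 2 := by
    rw [rootFun, ← neg_sub t s, ← neg_sub w s, ← neg_sub w t]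
    field_simp
    linear_combination -(w - t) * (s - p.1) * e1 + (w - s) * (t - p.1) * e2
  refine pos_of_mul_pos_left ?_ hwp.le
  rw [key]
  positivity

lemma eq_or_eq {w : ℝ} (hw : b < w) (h0 : rootFun μ p w = 0) : w = t ∨ w = s := by
  by_contra! hne
  have := h.rootFun_mul_pos hμ hab hb hw hne.2 hne.1
  simp [h0] at this

lemma mem_Ioo_of_neg {w : ℝ} (hw : b < w) (h0 : rootFun μ p w < 0) : s < w ∧ w < t := by
  have hws : w ≠ s := fun e => by rw [e, h.right_root] at h0; exact h0.false
  have hwt : w ≠ t := fun e => by rw [e, h.left_root] at h0; exact h0.false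
  have h1 := neg_of_mul_pos_right (h.rootFun_mul_pos hμ hab hb hw hws hwt) h0.le
  by_contra! hc
  rcases lt_or_gt_of_ne hws with h2 | h2
  · nlinarith [h.lt]
  · nlinarith [hc h2]

lemma lt_or_lt_of_pos {w : ℝ} (hw : b < w) (h0 : 0 < rootFun μ p w) : w < s ∨ t < w := by
  have hws : w ≠ s := fun e => by rw [e, h.right_root] at h0; exact h0.false
  have hwt : w ≠ t := fun e => by rw [e, h.left_root] at h0; exact h0.false
  have h1 := pos_of_mul_pos_right (h.rootFun_mul_pos hμ hab hb hw hws hwt) h0.le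
  by_contra! hc
  nlinarith [lt_of_le_of_ne hc.1 hws.symm, lt_of_le_of_ne hc.2 hwt]

/-- The two root equations are linear in `(χ, η)` with determinant `± (C(t) - C(s)) ≠ 0`. -/
lemma eq_paramOfRoots : p = paramOfRoots μ (t, s) := by
  have h1 := h.right_root
  have h2 := h.left_root
  rw [rootFun] at h1 h2
  have hne := (realCauchy_sub_neg hμ hab hb h.lt_right h.lt).ne
  ext
  · simp only [paramOfRoots]
    field_simp
    linear_combination h1 - h2
  · simp only [paramOfRoots]
    field_simp
    linear_combination realCauchy μ t * h1 - realCauchy μ s * h2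

end IsRootPair

lemma isRootPair_paramOfRoots (ha : a ∈ μ.support) (hs : b < s) (hst : s < t) :
    IsRootPair μ b (paramOfRoots μ (t, s)) t s := by
  have hneg := realCauchy_sub_neg hμ hab hb hs hst
  have hne := hneg.ne
  have hlt := sub_mul_realCauchy_lt hμ hab ha hs hst
  refine ⟨?_, hs, hst, ?_, ?_⟩
  · simp only [paramOfRoots]
    rw [div_lt_iff_of_neg hneg]
    linarith
  · simp only [rootFun, paramOfRoots]
    field_simp
    ring
  · simp only [rootFun, paramOfRoots]
    field_simp
    ring

end

/-! ### Bounds on the parameters and existence of a second root -/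

section
variable {μ : Measure ℝ} [IsProbabilityMeasure μ] {a b : ℝ} (hμ : ∀ᵐ x ∂μ, x ∈ Icc a b)
  {p : ℝ × ℝ} {s t : ℝ}
include hμ

lemma continuousOn_rootFun (p : ℝ × ℝ) : ContinuousOn (rootFun μ p) (Ioi b) := fun _ hw =>
  (hasDerivAt_rootFun hμ p hw).continuousAt.continuousWithinAt

lemma exists_rootFun_pos_lt (hmass : 0 < μ {b}) (hχ : p.1 < b) (hη : 0 < p.2) {u : ℝ}
    (hu : b < u) : ∃ w, b < w ∧ w < u ∧ 0 < rootFun μ p w := by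
  have hm : 0 < μ.real {b} := ENNReal.toReal_pos hmass.ne' (measure_ne_top μ _)
  have hχ' := sub_pos.2 hχ
  -- The first bound keeps `b + r` below `u`; the second makes the contribution of the atom at `b`
  -- to `(w - χ) C(w)` at least `1 > 1 - η`.
  set r := min ((u - b) / 2) ((b - p.1) * μ.real {b}) with hr
  have hr0 : 0 < r := lt_min (by linarith) (by positivity)
  have hr1 : r ≤ (u - b) / 2 := min_le_left _ _
  have hr2 : r ≤ (b - p.1) * μ.real {b} := min_le_right _ _
  refine ⟨b + r, by linarith, by linarith, ?_⟩
  have hC := atoms_le_realCauchy hμ hχ (show b < b + r by linarith)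
  have h1 : 0 ≤ μ.real {p.1} / (b + r - p.1) := div_nonneg measureReal_nonneg (by linarith)
  rw [add_sub_cancel_left] at hC
  have h2 : 1 ≤ (b - p.1) * (μ.real {b} / r) := by
    rw [← mul_div_assoc, le_div_iff₀ hr0]
    linarith
  have h3 : 0 < μ.real {b} / r := by positivity
  have h4 : (b - p.1) * (μ.real {b} / r) ≤ (b + r - p.1) * realCauchy μ (b + r) :=
    mul_le_mul (by linarith) (by linarith) h3.le (by linarith)
  rw [rootFun]
  linarith

lemma exists_rootFun_pos_gt (hab : a < b) (hχ : p.1 < b) (hη : 0 < p.2) {u : ℝ}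
    (hu : b < u) : ∃ w, u < w ∧ 0 < rootFun μ p w := by
  have hq : 0 ≤ |p.1 - a| / p.2 := by positivity
  -- Chosen so that `η (w - a) > |χ - a|`, hence `(w - χ) / (w - a) > 1 - η`.
  refine ⟨u + 1 + |p.1 - a| / p.2, by linarith, ?_⟩
  set w := u + 1 + |p.1 - a| / p.2 with hw
  have hbw : b < w := by linarith
  have hwa : 0 < w - a := by linarith
  have hC := one_div_sub_le_realCauchy hμ hbw
  have h1 : (w - p.1) * (1 / (w - a)) ≤ (w - p.1) * realCauchy μ w :=
    mul_le_mul_of_nonneg_left hC (by linarith)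
  have h2 : |p.1 - a| < p.2 * (w - a) := by
    rw [← div_lt_iff₀' hη]
    linarith
  have h3 : 1 - p.2 < (w - p.1) * (1 / (w - a)) := by
    rw [mul_one_div, lt_div_iff₀ hwa]
    linarith [le_abs_self (p.1 - a)]
  rw [rootFun]
  linarith

/-- If `χ ≤ a`, then `C(t) ≥ 1 / (t - a)` would give `(t - χ) C(t) ≥ 1 > 1 - η`. -/
lemma lt_fst_of_rootFun_eq_zero (hab : a < b) (hχ : p.1 < b) (hη : 0 < p.2) (ht : b < t)
    (h0 : rootFun μ p t = 0) : a < p.1 := by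
  have hta : 0 < t - a := by linarith
  have h1 : (t - p.1) * (1 / (t - a)) ≤ (t - p.1) * realCauchy μ t :=
    mul_le_mul_of_nonneg_left (one_div_sub_le_realCauchy hμ ht) (by linarith)
  rw [rootFun] at h0
  rw [mul_one_div, div_le_iff₀ hta] at h1
  nlinarith

lemma snd_lt_one_of_rootFun_eq_zero (hab : a < b) (hχ : p.1 < b) (ht : b < t)
    (h0 : rootFun μ p t = 0) : p.2 < 1 := by
  have := mul_pos (sub_pos.2 (hχ.trans ht)) (realCauchy_pos hμ hab ht)
  rw [rootFun] at h0
  linarith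

/-- The atom at `χ` alone contributes `μ{χ}` to `(t - χ) C(t) = 1 - η`; the atom at `b` makes the
inequality strict. -/
lemma measureReal_lt_of_rootFun_eq_zero (hmass : 0 < μ {b}) (hχ : p.1 < b) (ht : b < t)
    (h0 : rootFun μ p t = 0) : μ.real {p.1} < 1 - p.2 := by
  have hm : 0 < μ.real {b} := ENNReal.toReal_pos hmass.ne' (measure_ne_top μ _)
  have hp : 0 < t - p.1 := by linarith
  have h1 := atoms_le_realCauchy hμ hχ ht
  have h2 : 0 < μ.real {b} / (t - b) := div_pos hm (by linarith)
  have h3 : μ.real {p.1} / (t - p.1) < realCauchy μ t := by linarith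
  rw [div_lt_iff₀ hp] at h3
  rw [rootFun] at h0
  linarith

/-- Next to a simple root in `(b, ∞)` there is a second one. -/
lemma exists_isRootPair (hab : a < b) (hmass : 0 < μ {b}) (hχ : p.1 < b) (hη : 0 < p.2)
    (ht : b < t) (h0 : rootFun μ p t = 0) (h1 : rootFunDeriv μ p t ≠ 0) :
    ∃ q : ℝ × ℝ, IsRootPair μ b p q.1 q.2 := by
  have hslope := hasDerivAt_iff_tendsto_slope.1 (hasDerivAt_rootFun hμ p ht)
  have hcont : ∀ {c d : ℝ}, b < c → ContinuousOn (rootFun μ p) (Icc c d) := fun hc =>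
    (continuousOn_rootFun hμ p).mono fun x hx => hc.trans_le hx.1
  -- The sign of the derivative decides on which side of `t` the function turns negative, and so
  -- whether the second root lies above or below `t`.
  rcases lt_or_gt_of_ne h1 with h1 | h1
  · obtain ⟨u, hu, htu⟩ := (((hslope.eventually (gt_mem_nhds h1)).filter_mono
      (nhdsGT_le_nhdsNE t)).and self_mem_nhdsWithin).exists
    replace htu : t < u := htu
    rw [slope_def_field, h0, sub_zero, div_neg_iff] at hu
    have hu0 : rootFun μ p u < 0 := by
      rcases hu with hu | hu
      · linarith [hu.2]
      · exact hu.1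
    obtain ⟨w, huw, hw⟩ := exists_rootFun_pos_gt hμ hab hχ hη (ht.trans htu)
    obtain ⟨v, hv, hv0⟩ := intermediate_value_Ioo huw.le (hcont (ht.trans htu)) ⟨hu0, hw⟩
    exact ⟨(v, t), hχ, ht, htu.trans hv.1, hv0, h0⟩
  · obtain ⟨u, hu, htu⟩ := (((hslope.eventually (lt_mem_nhds h1)).filter_mono
      (nhdsLT_le_nhdsNE t)).and (Ioo_mem_nhdsLT ht)).exists
    rw [slope_def_field, h0, sub_zero, div_pos_iff] at hu
    have hu0 : rootFun μ p u < 0 := by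
      rcases hu with hu | hu
      · linarith [hu.2, htu.2]
      · exact hu.1
    obtain ⟨w, hbw, hwu, hw⟩ := exists_rootFun_pos_lt hμ hmass hχ hη htu.1
    obtain ⟨v, hv, hv0⟩ := intermediate_value_Ioo' hwu.le (hcont hbw) ⟨hu0, hw⟩
    exact ⟨(t, v), hχ, hbw.trans hv.1, hv.2.trans htu.2, h0, hv0⟩

lemma IsSimpleRootPair.isRootPair (hχ : p.1 < b) (hst : s < t) (h : IsSimpleRootPair μ b p t s) :
    IsRootPair μ b p t s := by
  have ht : t ∈ rootSetAbove μ b p := by rw [h.1]; simp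
  have hs : s ∈ rootSetAbove μ b p := by rw [h.1]; simp
  exact ⟨hχ, hs.1, hst, (steepestDeriv_eq_zero_iff hμ hχ ht.1).1 ht.2,
    (steepestDeriv_eq_zero_iff hμ hχ hs.1).1 hs.2⟩

lemma exists_isRootPair_of_mem_lowRig (hab : a < b) (hmass : 0 < μ {b}) (hp : p ∈ lowRig μ a b) :
    ∃ q : ℝ × ℝ, IsRootPair μ b p q.1 q.2 := by
  obtain ⟨-, hχ, hη, t, ht, hord⟩ := hp
  obtain ⟨h0, h1⟩ := (analyticOrderAt_steepestDeriv_eq_one_iff hμ hχ ht).1 hord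
  exact exists_isRootPair hμ hab hmass hχ hη ht h0 h1

/-! ### Continuity in both directions and the homeomorphism -/

variable (hab : a < b) (hb : b ∈ μ.support)
include hab hb

lemma continuousOn_paramOfRoots : ContinuousOn (paramOfRoots μ) (wedge b) := by
  have hC : ContinuousOn (realCauchy μ) (Ioi b) := fun w hw =>
    (hasDerivAt_realCauchy hμ hw).continuousAt.continuousWithinAt
  have h1 : ContinuousOn (fun q : ℝ × ℝ => realCauchy μ q.1) (wedge b) :=
    hC.comp continuousOn_fst fun q hq => hq.1.1
  have h2 : ContinuousOn (fun q : ℝ × ℝ => realCauchy μ q.2) (wedge b) :=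
    hC.comp continuousOn_snd fun q hq => hq.1.2
  have hne : ∀ q ∈ wedge b, realCauchy μ q.1 - realCauchy μ q.2 ≠ 0 := fun q hq =>
    (realCauchy_sub_neg hμ hab hb hq.1.2 hq.2).ne
  unfold paramOfRoots
  fun_prop (disch := assumption)

namespace IsRootPair

lemma isSimpleRootPair (h : IsRootPair μ b p t s) : IsSimpleRootPair μ b p t s := by
  have ht := h.lt_right.trans h.lt
  refine ⟨?_, ?_, ?_⟩
  · ext w
    simp only [rootSetAbove, mem_ofPred_eq, mem_insert_iff, mem_singleton_iff]
    constructor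
    · rintro ⟨hw, h0⟩
      exact h.eq_or_eq hμ hab hb hw ((steepestDeriv_eq_zero_iff hμ h.fst_lt hw).1 h0)
    · rintro (rfl | rfl)
      · exact ⟨ht, (steepestDeriv_eq_zero_iff hμ h.fst_lt ht).2 h.left_root⟩
      · exact ⟨h.lt_right, (steepestDeriv_eq_zero_iff hμ h.fst_lt h.lt_right).2 h.right_root⟩
  · exact (analyticOrderAt_steepestDeriv_eq_one_iff hμ h.fst_lt ht).2 ⟨h.left_root,
      rootFunDeriv_ne_zero hμ hab hb h.fst_lt ht h.lt_right h.lt.ne' h.left_root h.right_root⟩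
  · exact (analyticOrderAt_steepestDeriv_eq_one_iff hμ h.fst_lt h.lt_right).2 ⟨h.right_root,
      rootFunDeriv_ne_zero hμ hab hb h.fst_lt h.lt_right ht h.lt.ne h.right_root h.left_root⟩

lemma mem_lowRig (h : IsRootPair μ b p t s) : p ∈ lowRig μ a b := by
  have hη := h.snd_pos hμ hab hb
  exact ⟨⟨⟨(lt_fst_of_rootFun_eq_zero hμ hab h.fst_lt hη h.lt_right h.right_root).le,
    h.fst_lt.le⟩, hη.le,
    (snd_lt_one_of_rootFun_eq_zero hμ hab h.fst_lt h.lt_right h.right_root).le⟩, h.fst_lt, hη,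
    s, h.lt_right, (h.isSimpleRootPair hμ hab hb).2.2⟩

lemma unique {t' s' : ℝ} (h : IsRootPair μ b p t s) (h' : IsRootPair μ b p t' s') :
    t = t' ∧ s = s' := by
  have ht := h'.eq_or_eq hμ hab hb (h.lt_right.trans h.lt) h.left_root
  have hs := h'.eq_or_eq hμ hab hb h.lt_right h.right_root
  have := h.lt
  have := h'.lt
  rcases ht with rfl | rfl <;> rcases hs with rfl | rfl
  · linarith
  · exact ⟨rfl, rfl⟩
  · linarith
  · linarith

/-- The roots of `f'_{(χ,η)}` depend continuously on `(χ, η)`. -/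
lemma eventually_dist_lt (h : IsRootPair μ b p t s) {ε : ℝ} (hε : 0 < ε) :
    ∀ᶠ p' in nhds p, ∀ t' s', IsRootPair μ b p' t' s' → dist (t', s') (t, s) < ε := by
  have hbs := h.lt_right
  have hst := h.lt
  -- With `δ < s - b` the point `s - δ` stays above `b`; with `δ < (t - s) / 2` the intervals around
  -- `s` and `t` are disjoint.
  obtain ⟨δ, hδ, hδ'⟩ := exists_between
    (show 0 < min ε (min (s - b) ((t - s) / 2)) from
      lt_min hε (lt_min (by linarith) (by linarith)))
  rw [lt_min_iff, lt_min_iff] at hδ'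
  obtain ⟨hδε, hδb, hδs⟩ := hδ'
  have hc : ∀ w, Continuous fun p' : ℝ × ℝ => rootFun μ p' w := fun w => by
    unfold rootFun
    fun_prop
  have hsign : ∀ w, b < w → w ≠ s → w ≠ t → 0 < rootFun μ p w * ((w - s) * (w - t)) :=
    fun w => h.rootFun_mul_pos hμ hab hb
  have h1 : 0 < rootFun μ p (s - δ) :=
    pos_of_mul_pos_left (hsign (s - δ) (by linarith) (by linarith) (by linarith)) (by nlinarith)
  have h2 : rootFun μ p (s + δ) < 0 :=
    neg_of_mul_pos_left (hsign (s + δ) (by linarith) (by linarith) (by linarith)) (by nlinarith)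
  have h3 : rootFun μ p (t - δ) < 0 :=
    neg_of_mul_pos_left (hsign (t - δ) (by linarith) (by linarith) (by linarith)) (by nlinarith)
  have h4 : 0 < rootFun μ p (t + δ) :=
    pos_of_mul_pos_left (hsign (t + δ) (by linarith) (by linarith) (by linarith)) (by nlinarith)
  -- The signs `+, -, -, +` at `s - δ`, `s + δ`, `t - δ`, `t + δ` persist for nearby parameters. The
  -- function is negative exactly between its two roots, so these are trapped within `δ` of `s` and
  -- `t`.
  filter_upwards [(hc (s - δ)).continuousAt.eventually (lt_mem_nhds h1),
    (hc (s + δ)).continuousAt.eventually (gt_mem_nhds h2),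
    (hc (t - δ)).continuousAt.eventually (gt_mem_nhds h3),
    (hc (t + δ)).continuousAt.eventually (lt_mem_nhds h4)] with p' g1 g2 g3 g4 t' s' h'
  have k1 := h'.lt_or_lt_of_pos hμ hab hb (by linarith) g1
  have k2 := h'.mem_Ioo_of_neg hμ hab hb (by linarith) g2
  have k3 := h'.mem_Ioo_of_neg hμ hab hb (by linarith) g3
  have k4 := h'.lt_or_lt_of_pos hμ hab hb (by linarith) g4
  have l1 : s - δ < s' := k1.resolve_right (by linarith [k2.2])
  have l4 : t' < t + δ := k4.resolve_left (by linarith [k3.1])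
  rw [Prod.dist_eq, max_lt_iff, Real.dist_eq, Real.dist_eq, abs_lt, abs_lt]
  refine ⟨⟨?_, ?_⟩, ?_, ?_⟩ <;> dsimp only <;> linarith [k2.1, k3.2]

end IsRootPair

/-- The parameter set is homeomorphic to the wedge through the roots. -/
lemma exists_homeomorph_isRootPair (ha : a ∈ μ.support) (hmass : 0 < μ {b}) :
    ∃ W : lowRig μ a b ≃ₜ wedge b,
      (∀ p : lowRig μ a b, IsRootPair μ b p.1 (W p).1.1 (W p).1.2) ∧
      ∀ q : wedge b, (W.symm q).1 = paramOfRoots μ q.1 := by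
  choose r hr using fun p : lowRig μ a b =>
    exists_isRootPair_of_mem_lowRig hμ hab hmass p.2
  have hpar : ∀ q : wedge b, IsRootPair μ b (paramOfRoots μ q.1) q.1.1 q.1.2 := fun q =>
    isRootPair_paramOfRoots hμ hab hb ha q.2.1.2 q.2.2
  refine ⟨{
    toFun := fun p => ⟨r p, ⟨(hr p).lt_right.trans (hr p).lt, (hr p).lt_right⟩, (hr p).lt⟩
    invFun := fun q => ⟨paramOfRoots μ q.1, (hpar q).mem_lowRig hμ hab hb⟩
    left_inv := fun p => Subtype.ext ((hr p).eq_paramOfRoots hμ hab hb).symm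
    right_inv := fun q => ?_
    continuous_toFun := ?_
    continuous_invFun := ?_ }, hr, fun q => rfl⟩
  · have h := (hr ⟨paramOfRoots μ q.1, (hpar q).mem_lowRig hμ hab hb⟩).unique hμ hab hb (hpar q)
    exact Subtype.ext (Prod.ext h.1 h.2)
  · refine Continuous.subtype_mk (continuous_iff_continuousAt.2 fun p => ?_) _
    refine Metric.tendsto_nhds.2 fun ε hε => ?_
    filter_upwards [continuous_subtype_val.continuousAt.eventually
      ((hr p).eventually_dist_lt hμ hab hb hε)] with p' hp'
    exact hp' _ _ (hr p')
  · exact (continuousOn_iff_continuous_domRestrict.1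
      (continuousOn_paramOfRoots hμ hab hb)).subtype_mk _

end

theorem mainTheorem4 (μ : Measure ℝ) [IsProbabilityMeasure μ] (a b : ℝ) (hab : a < b)
    (hsupp : μ.support ⊆ Icc a b) (ha : a ∈ μ.support) (hb : b ∈ μ.support)
    (hmass : 0 < μ {b}) :
    lowRig μ a b =
        {p : ℝ × ℝ | p ∈ Ioo a b ×ˢ Ioo (0 : ℝ) 1 ∧ μ.real {p.1} < 1 - p.2 ∧
          ∃ t s : ℝ, s < t ∧ IsSimpleRootPair μ b p t s} ∧
      ∃ W : lowRig μ a b ≃ₜ wedge b,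
        (∀ p : lowRig μ a b, IsSimpleRootPair μ b p.1 (W p).1.1 (W p).1.2) ∧
        ∀ (t s : ℝ) (hts : (t, s) ∈ wedge b),
          cauchyTransform μ t - cauchyTransform μ s ≠ 0 ∧
          (((W.symm ⟨(t, s), hts⟩).1.1 : ℝ) : ℂ) =
            (t * cauchyTransform μ t - s * cauchyTransform μ s) /
              (cauchyTransform μ t - cauchyTransform μ s) ∧
          (((W.symm ⟨(t, s), hts⟩).1.2 : ℝ) : ℂ) =
            1 + cauchyTransform μ t * cauchyTransform μ s * (t - s) /
              (cauchyTransform μ t - cauchyTransform μ s) := by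
  have hμ := ae_mem_Icc_of_support_subset hsupp
  refine ⟨?_, ?_⟩
  · ext p
    constructor
    · intro hp
      obtain ⟨q, hq⟩ := exists_isRootPair_of_mem_lowRig hμ hab hmass hp
      have hη := hq.snd_pos hμ hab hb
      exact ⟨⟨⟨lt_fst_of_rootFun_eq_zero hμ hab hq.fst_lt hη hq.lt_right hq.right_root, hq.fst_lt⟩,
        hη, snd_lt_one_of_rootFun_eq_zero hμ hab hq.fst_lt hq.lt_right hq.right_root⟩,
        measureReal_lt_of_rootFun_eq_zero hμ hmass hq.fst_lt hq.lt_right hq.right_root,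
        q.1, q.2, hq.lt, hq.isSimpleRootPair hμ hab hb⟩
    · rintro ⟨⟨hχ, -⟩, -, t, s, hst, h⟩
      exact (h.isRootPair hμ hχ.2 hst).mem_lowRig hμ hab hb
  · obtain ⟨W, hW, hsymm⟩ := exists_homeomorph_isRootPair hμ hab hb ha hmass
    refine ⟨W, fun p => (hW p).isSimpleRootPair hμ hab hb, fun t s hts => ⟨?_, ?_, ?_⟩⟩
    · rw [cauchyTransform_ofReal, cauchyTransform_ofReal, ← Complex.ofReal_sub,
        Complex.ofReal_ne_zero]
      exact (realCauchy_sub_neg hμ hab hb hts.1.2 hts.2).ne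
    · rw [hsymm, cauchyTransform_ofReal, cauchyTransform_ofReal]
      simp only [paramOfRoots]
      push_cast
      rfl
    · rw [hsymm, cauchyTransform_ofReal, cauchyTransform_ofReal]
      simp only [paramOfRoots]
      push_cast
      rfl
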